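/- Let $d\ge 1$, $p\in(1,\infty)$, $\delta,\delta'\in[0,2)$, and let $d_H$ be a real number with $$d-d_H+p(\delta\wedge\delta')-2p\;\ge\;2p\,|\delta-\delta'|\,(2-\delta\vee\delta')^{-1},$$ where, in the case $\delta=\delta'$, the inequality is assumed to be strict (so that always $d-d_H+p(\delta\wedge\delta')-2p>0$). Put $C_p=(p-1)(d-d_H)\,(d-d_H+p(\delta\wedge\delta')-2p)\,p^{-2}$. Then there is a constant $c_p\in(0,C_p]$, depending only on $d,p,\delta,\delta'$ and $d_H$, with $c_p=C_p$ if $\delta=\delta'$, such that the following holds. Let $K\subseteq\mathbf R^d$ be a non-empty closed convex set, $\Omega=\mathbf R^d\setminus K$, and suppose that the boundary $\Gamma=\partial\Omega$ has Hausdorff dimension $d_H$. Let $d_\Gamma(x)=\inf_{y\in\Omega^c}|x-y|$ be the Euclidean distance to the boundary, let $c_\Omega=c\circ d_\Gamma$ with $c(s)=s^\delta(1+s)^{\delta'-\delta}$, and let $H\varphi=-\mathrm{div}(c_\Omega\nabla\varphi)=-\sum_{k=1}^d\partial_k(c_\Omega\,\partial_k\varphi)$. Then $$\int_\Omega|H\varphi|^p\;\ge\;c_p^{\,p}\int_\Omega|c_\Omega\,d_\Gamma^{-2}\varphi|^p$$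 for all real-valued $\varphi\in C_c^2(\Omega)$, i.e. twice continuously differentiable functions with compact support in $\Omega$. -/

import Mathlib

open MeasureTheory

noncomputable section

/-- The weight profile `c(s) = s^δ (1 + s)^(δ' - δ)`, which behaves like `s^δ` as `s → 0` and like
`s^δ'` as `s → ∞`. -/
def weightProfile (δ δ' s : ℝ) : ℝ := s ^ δ * (1 + s) ^ (δ' - δ)

/-- The Euclidean distance `d_Γ(x) = inf {|x - y| : y ∈ Ωᶜ}`, which for `x` in the open set `Ω` is
the distance to the boundary `Γ` of `Ω`. -/
def boundaryDist {d : ℕ} (Ω : Set (EuclideanSpace ℝ (Fin d))) (x : EuclideanSpace ℝ (Fin d)) : ℝ :=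
  Metric.infDist x Ωᶜ

/-- The coefficient `c_Ω = c ∘ d_Γ`. -/
def domainWeight {d : ℕ} (δ δ' : ℝ) (Ω : Set (EuclideanSpace ℝ (Fin d)))
    (x : EuclideanSpace ℝ (Fin d)) : ℝ :=
  weightProfile δ δ' (boundaryDist Ω x)

/-- The partial derivative `∂ₖ f` at `x`. -/
def partialDeriv {d : ℕ} (k : Fin d) (f : EuclideanSpace ℝ (Fin d) → ℝ)
    (x : EuclideanSpace ℝ (Fin d)) : ℝ :=
  fderiv ℝ f x (EuclideanSpace.single k 1)

/-- The operator `H φ = -div(a ∇φ) = -∑ₖ ∂ₖ (a ∂ₖ φ)` with scalar coefficient `a`. -/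
def divFormOp {d : ℕ} (a φ : EuclideanSpace ℝ (Fin d) → ℝ) (x : EuclideanSpace ℝ (Fin d)) : ℝ :=
  -∑ k : Fin d, partialDeriv k (fun y => a y * partialDeriv k φ y) x

/-- `φ ∈ C_c^2(Ω)`: a real-valued, twice continuously differentiable function with compact support
contained in `Ω` (extended by zero to the whole space). -/
structure IsCc2 {d : ℕ} (Ω : Set (EuclideanSpace ℝ (Fin d)))
    (φ : EuclideanSpace ℝ (Fin d) → ℝ) : Prop where
  contDiff : ContDiff ℝ 2 φ
  hasCompactSupport : HasCompactSupport φ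
  tsupport_subset : tsupport φ ⊆ Ω

/-- The constant `C_p = (p - 1) (d - d_H) (d - d_H + p (δ ∧ δ') - 2p) / p²`. -/
def rellichConst (d : ℕ) (dH p δ δ' : ℝ) : ℝ :=
  (p - 1) * (d - dH) * (d - dH + p * min δ δ' - 2 * p) / p ^ 2

end

/-! Let `P` be the nearest point projection onto `K`, v(x) = x - P x and D = |v|, so that D is the
distance to `K` and v = ∇(D²/2) outside `K`. Convexity enters through one fact: v is monotone and
1-Lipschitz, and its divergence is at least N = d - d_H almost everywhere off `K`
(`IsMetricProjection.finrank_sub_dimH_le_trace`). Integration by parts turns this into ∫ (v·∇ψ + Nψ)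
≤ 0 for C¹ functions ψ ≥ 0 with compact support off `K`
(`IsMetricProjection.mul_integral_le_neg_integral_sum`).

Put b = c(D)/D² and test Hφ against b^(p-1)|φ|^(p-2)φ. In the energy ∫ c_Ω ∇φ·∇(b^(p-1)|φ|^(p-2)φ),
completing a square with a parameter τ replaces the term quadratic in ∇φ by one linear in v·∇φ. All
linear terms then combine into -h(D) v·∇(|φ|^p/p), and the divergence bound with ψ = h(D)|φ|^p/p
makes the energy at least c_p ∫ b^p|φ|^p (`IsMetricProjection.energy_density_ge`,
`weightedRellichConst_mul_le_fieldProfile`). Hölder's inequality then gives the L^p estimate. Since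
|φ|^(p-2)φ need not be C¹, |φ|² is first replaced by φ² + ε, and ε tends to 0. -/

open Filter Topology Module
open scoped RealInnerProductSpace NNReal

/-! ### Nearest point projection: monotonicity, differentiability of the distance, invariance along
normals. -/

section MetricProjection

variable {E : Type*} [NormedAddCommGroup E] [InnerProductSpace ℝ E]

/-- `P` is the nearest point projection onto the convex set `K`, by its variational
characterization. -/
structure IsMetricProjection (K : Set E) (P : E → E) : Prop where
  mem : ∀ x, P x ∈ K
  inner_le : ∀ x, ∀ y ∈ K, ⟪x - P x, y - P x⟫ ≤ 0

theorem exists_isMetricProjection [CompleteSpace E] {K : Set E} (hc : IsClosed K)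
    (hK : Convex ℝ K) (hne : K.Nonempty) : ∃ P : E → E, IsMetricProjection K P := by
  choose P hP using fun x => exists_norm_eq_iInf_of_complete_convex hne hc.isComplete hK x
  exact ⟨P, fun x => (hP x).1,
    fun x => (norm_eq_iInf_iff_real_inner_le_zero hK (hP x).1).1 (hP x).2⟩

namespace IsMetricProjection

variable {K : Set E} {P : E → E} (hP : IsMetricProjection K P)
include hP

theorem norm_sub_le {x y : E} (hy : y ∈ K) : ‖x - P x‖ ≤ ‖x - y‖ := by
  have h := hP.inner_le x y hy
  have e : ‖x - y‖ ^ 2 = ‖x - P x‖ ^ 2 - 2 * ⟪x - P x, y - P x⟫ + ‖y - P x‖ ^ 2 := by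
    rw [← norm_sub_sq_real]; congr 2; abel
  refine le_of_sq_le_sq ?_ (norm_nonneg _)
  nlinarith [sq_nonneg ‖y - P x‖]

theorem infDist_eq (x : E) : Metric.infDist x K = ‖x - P x‖ := by
  apply le_antisymm
  · rw [← dist_eq_norm]; exact Metric.infDist_le_dist_of_mem (hP.mem x)
  · refine (Metric.le_infDist ⟨_, hP.mem x⟩).2 fun {y} hy => ?_
    rw [dist_eq_norm]; exact hP.norm_sub_le hy

theorem eq_of_inner_le {x z : E} (hz : z ∈ K) (h : ∀ y ∈ K, ⟪x - z, y - z⟫ ≤ 0) : P x = z := by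
  have h1 := hP.inner_le x z hz
  have h2 := h _ (hP.mem x)
  have e : ⟪x - P x, z - P x⟫ + ⟪x - z, P x - z⟫ = ‖P x - z‖ ^ 2 := by
    rw [← real_inner_self_eq_norm_sq, ← neg_sub (P x) z, inner_neg_right, neg_add_eq_sub,
      ← inner_sub_left]
    congr 1; abel
  have : ‖P x - z‖ = 0 := by nlinarith [norm_nonneg (P x - z)]
  exact sub_eq_zero.1 (norm_eq_zero.1 this)

/-- Adding the variational inequalities at x and y gives firm nonexpansiveness, hence both the
Lipschitz bound and the monotonicity of the displacement. -/
theorem norm_sub_sq_le_inner (x y : E) :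
    ‖(x - P x) - (y - P y)‖ ^ 2 ≤ ⟪(x - P x) - (y - P y), x - y⟫ := by
  have h1 := hP.inner_le x _ (hP.mem y)
  have h2 := hP.inner_le y _ (hP.mem x)
  have e : x - y = ((x - P x) - (y - P y)) + (P x - P y) := by abel
  have e2 : ⟪(x - P x) - (y - P y), P x - P y⟫
      = -⟪x - P x, P y - P x⟫ - ⟪y - P y, P x - P y⟫ := by
    rw [← inner_neg_right, neg_sub, inner_sub_left]
  conv_rhs => rw [e, inner_add_right, real_inner_self_eq_norm_sq, e2]
  linarith

theorem lipschitzWith_sub : LipschitzWith 1 (fun x => x - P x) := by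
  refine LipschitzWith.of_dist_le_mul fun x y => ?_
  simp only [dist_eq_norm, NNReal.coe_one, one_mul]
  have h := (hP.norm_sub_sq_le_inner x y).trans (real_inner_le_norm _ _)
  by_contra! hlt
  nlinarith [norm_nonneg (x - y), norm_nonneg ((x - P x) - (y - P y))]

theorem inner_sub_nonneg (x y : E) : 0 ≤ ⟪(x - P x) - (y - P y), x - y⟫ :=
  (sq_nonneg _).trans (hP.norm_sub_sq_le_inner x y)

/-- P x is a competitor for the distance from y, which yields a one-sided second-order expansion of
the squared distance. -/
theorem norm_sub_sq_le (x y : E) :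
    ‖y - P y‖ ^ 2 ≤ ‖x - P x‖ ^ 2 + 2 * ⟪x - P x, y - x⟫ + ‖y - x‖ ^ 2 := by
  have h := hP.norm_sub_le (x := y) (hP.mem x)
  have e : ‖y - P x‖ ^ 2 = ‖x - P x‖ ^ 2 + 2 * ⟪x - P x, y - x⟫ + ‖y - x‖ ^ 2 := by
    rw [← norm_add_sq_real]; congr 2; abel
  rw [← e]
  gcongr

theorem hasFDerivAt_norm_sub_sq (x : E) :
    HasFDerivAt (fun y => ‖y - P y‖ ^ 2) ((2 : ℝ) • innerSL ℝ (x - P x)) x := by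
  rw [hasFDerivAt_iff_isLittleO]
  have hO : (fun y => ‖y - P y‖ ^ 2 - ‖x - P x‖ ^ 2
      - ((2 : ℝ) • innerSL ℝ (x - P x)) (y - x)) =O[𝓝 x] fun y => ‖y - x‖ ^ 2 := by
    refine Asymptotics.IsBigO.of_bound 1 (Eventually.of_forall fun y => ?_)
    -- The expansion at x bounds the remainder above. The expansion at y, with monotonicity to
    -- return its gradient to x, bounds it below.
    have h1 := hP.norm_sub_sq_le x y
    have h2 := hP.norm_sub_sq_le y x
    have h3 := hP.inner_sub_nonneg y x
    have e1 : ⟪y - P y, x - y⟫ = -⟪y - P y, y - x⟫ := by rw [← inner_neg_right, neg_sub]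
    have e2 : ‖x - y‖ = ‖y - x‖ := norm_sub_rev _ _
    rw [inner_sub_left] at h3
    rw [e1, e2] at h2
    simp only [_root_.smul_apply, innerSL_apply_apply, smul_eq_mul, one_mul,
      Real.norm_eq_abs, abs_of_nonneg (sq_nonneg ‖y - x‖)]
    rw [abs_le]
    constructor <;> linarith
  refine hO.trans_isLittleO ?_
  have : (fun y : E => ‖y - x‖ ^ 2) =o[𝓝 x] fun y => ‖y - x‖ ^ 1 := by
    have h0 := (Asymptotics.isLittleO_pow_pow (𝕜 := ℝ) (show 1 < 2 by norm_num))
    have ht : Tendsto (fun y : E => ‖y - x‖) (𝓝 x) (𝓝 0) := by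
      have : Continuous fun y : E => ‖y - x‖ := by fun_prop
      simpa using this.tendsto x
    exact h0.comp_tendsto ht
  simpa using this.norm_right

theorem norm_sub_pos {x : E} (hx : x ∈ Kᶜ) : 0 < ‖x - P x‖ := by
  rw [norm_pos_iff, sub_ne_zero]
  intro h
  exact hx (h ▸ hP.mem x)

theorem hasFDerivAt_norm_sub {x : E} (hx : x ∈ Kᶜ) :
    HasFDerivAt (fun y => ‖y - P y‖) (‖x - P x‖⁻¹ • innerSL ℝ (x - P x)) x := by
  have h0 : x - P x ≠ 0 := by
    rw [sub_ne_zero]; intro h; exact hx (h ▸ hP.mem x)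
  have h1 := (hP.hasFDerivAt_norm_sub_sq x).sqrt (pow_ne_zero 2 (norm_ne_zero_iff.2 h0))
  simp only [Real.sqrt_sq (norm_nonneg _), smul_smul] at h1
  convert h1 using 2
  field_simp

theorem contDiffOn_norm_sub (hc : IsClosed K) :
    ContDiffOn ℝ 1 (fun y => ‖y - P y‖) Kᶜ := by
  rw [← zero_add (1 : WithTop ℕ∞), contDiffOn_succ_iff_fderiv_of_isOpen hc.isOpen_compl]
  refine ⟨fun x hx => (hP.hasFDerivAt_norm_sub hx).differentiableAt.differentiableWithinAt,
    by simp, contDiffOn_zero.2 ?_⟩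
  refine ContinuousOn.congr (f := fun x => ‖x - P x‖⁻¹ • innerSL ℝ (x - P x)) ?_
    fun x hx => (hP.hasFDerivAt_norm_sub hx).fderiv
  have hv := hP.lipschitzWith_sub.continuous
  refine ContinuousOn.smul (ContinuousOn.inv₀ hv.norm.continuousOn
    fun x hx => (hP.norm_sub_pos hx).ne') ?_
  exact ((innerSL ℝ).continuous.comp hv).continuousOn

/-- Nonnegative multiples of x - P x stay in the normal cone at P x, so P is constant along that
ray. -/
theorem add_smul_sub (x : E) {t : ℝ} (ht : 0 ≤ 1 + t) : P (x + t • (x - P x)) = P x := by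
  refine hP.eq_of_inner_le (hP.mem x) fun y hy => ?_
  have : x + t • (x - P x) - P x = (1 + t) • (x - P x) := by rw [add_smul, one_smul]; abel
  rw [this, real_inner_smul_left]
  exact mul_nonpos_of_nonneg_of_nonpos ht (hP.inner_le x y hy)

theorem add_orthogonal (x : E) {w : E} (hw : ∀ y ∈ K, ∀ z ∈ K, ⟪w, y - z⟫ = 0) :
    P (x + w) = P x := by
  refine hP.eq_of_inner_le (hP.mem x) fun y hy => ?_
  rw [add_sub_right_comm, inner_add_left, hw y hy _ (hP.mem x), add_zero]
  exact hP.inner_le x y hy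

theorem inner_fderiv_nonneg {x : E} (hd : DifferentiableAt ℝ (fun y => y - P y) x) (u : E) :
    0 ≤ ⟪fderiv ℝ (fun y => y - P y) x u, u⟫ := by
  have h := hd.hasFDerivAt.hasLineDerivAt u
  have h2 := h.tendsto_slope_zero.inner (𝕜 := ℝ) (tendsto_const_nhds (x := u))
  refine ge_of_tendsto h2 ?_
  filter_upwards [self_mem_nhdsWithin] with t ht
  have ht : t ≠ 0 := ht
  have h3 := hP.inner_sub_nonneg (x + t • u) x
  rw [add_sub_cancel_left, real_inner_smul_right] at h3
  rw [real_inner_smul_left]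
  have : t⁻¹ * ⟪x + t • u - P (x + t • u) - (x - P x), u⟫
    = (t⁻¹) ^ 2 * (t * ⟪x + t • u - P (x + t • u) - (x - P x), u⟫) := by field_simp
  rw [this]
  positivity

end IsMetricProjection

/-- A positive operator acting as the identity on a subspace has trace at least the dimension of
the subspace. -/
theorem finrank_le_trace_of_eqOn [FiniteDimensional ℝ E] (L : E →ₗ[ℝ] E)
    (hL : ∀ u, 0 ≤ ⟪L u, u⟫) (U : Submodule ℝ E) (hU : ∀ u ∈ U, L u = u) :
    (finrank ℝ U : ℝ) ≤ LinearMap.trace ℝ E L := by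
  classical
  let b := stdOrthonormalBasis ℝ U
  let f : Fin (finrank ℝ U) → E := fun i => b i
  have hf : Orthonormal ℝ f := b.orthonormal.comp_linearIsometry U.subtypeₗᵢ
  have hf' : Orthonormal ℝ ((↑) : Set.range f → E) := hf.toSubtypeRange
  -- In an orthonormal basis extending one of U, the diagonal entries are 1 on U and nonnegative
  -- elsewhere. No symmetry of L is needed.
  obtain ⟨u, B, hsub, hB⟩ := hf'.exists_orthonormalBasis_extension
  rw [LinearMap.trace_eq_sum_inner L B, hB]
  have hs : Finset.univ.image f ⊆ u := by
    intro z hz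
    apply hsub
    simpa using hz
  have e1 : ∑ i : u, ⟪(i : E), L i⟫ = ∑ i ∈ u, ⟪i, L i⟫ :=
    Finset.sum_coe_sort u fun i => ⟪i, L i⟫
  rw [e1]
  calc (finrank ℝ U : ℝ) = ∑ i ∈ Finset.univ.image f, ⟪i, L i⟫ := by
        rw [Finset.sum_image hf.linearIndependent.injective.injOn]
        rw [Finset.sum_congr rfl (g := fun _ => (1 : ℝ))]
        · simp
        · intro i _
          rw [hU (f i) (b i).2, real_inner_self_eq_norm_sq, hf.norm_eq_one]; norm_num
    _ ≤ _ := Finset.sum_le_sum_of_subset_of_nonneg hs fun i _ _ => by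
        rw [real_inner_comm]; exact hL i

end MetricProjection

/-! ### Dimension of the boundary and the divergence of the displacement. -/

section FrontierDimension

variable {E : Type*} [NormedAddCommGroup E] [InnerProductSpace ℝ E] [FiniteDimensional ℝ E]

/-- The intrinsic interior is nonempty, so an isometric copy of the direction space meets K in a set
with interior. -/
theorem Convex.finrank_direction_le_dimH {K : Set E} (hK : Convex ℝ K) (hne : K.Nonempty) :
    (finrank ℝ (affineSpan ℝ K).direction : ENNReal) ≤ dimH K := by
  obtain ⟨_, y, hy, rfl⟩ := hne.intrinsicInterior hK
  let f : (affineSpan ℝ K).direction → E := fun w => (w : E) + y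
  let g : (affineSpan ℝ K).direction → affineSpan ℝ K := fun w =>
    ⟨(w : E) + y, AffineSubspace.vadd_mem_of_mem_direction w.2 y.2⟩
  have hf : Isometry f := Isometry.of_dist_eq fun a b => by
    simp only [f, dist_add_right]; rfl
  have hg : Continuous g := hf.continuous.subtype_mk _
  have hi : (interior (f ⁻¹' K)).Nonempty := by
    refine ⟨0, mem_interior.2 ⟨g ⁻¹' interior ((↑) ⁻¹' K), fun w hw => ?_,
      isOpen_interior.preimage hg, ?_⟩⟩
    · exact interior_subset (s := ((↑) ⁻¹' K : Set (affineSpan ℝ K))) hw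
    · have : g 0 = y := Subtype.ext (by simp [g])
      simpa [this] using hy
  rw [← Real.dimH_of_nonempty_interior hi, ← hf.dimH_image]
  exact dimH_mono (Set.image_preimage_subset f K)

/-- Segments parallel to x - x₀ from near the interior point x₀ to near x must cross the frontier.
Its orthogonal projection along x - x₀ thus contains an open subset of a hyperplane, and projections
do not raise Hausdorff dimension. -/
theorem finrank_le_dimH_frontier_add_one {K : Set E} (hi : (interior K).Nonempty)
    (hc : IsClosed K) {x : E} (hx : x ∉ K) :
    (finrank ℝ E : ENNReal) ≤ dimH (frontier K) + 1 := by
  obtain ⟨x₀, hx₀⟩ := hi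
  let W : Submodule ℝ E := (ℝ ∙ (x - x₀))ᗮ
  have hne : x - x₀ ≠ 0 := by
    rw [sub_ne_zero]; rintro rfl; exact hx (interior_subset hx₀)
  have hfr : finrank ℝ W + 1 = finrank ℝ E := by
    have := Submodule.finrank_add_finrank_orthogonal (ℝ ∙ (x - x₀))
    rw [finrank_span_singleton hne] at this
    change 1 + finrank ℝ W = _ at this
    omega
  let π : E → W := fun z => W.orthogonalProjectionOnto z
  have hπ : LipschitzWith 1 π := by
    refine LipschitzWith.of_dist_le_mul fun a b => ?_
    simp only [π, dist_eq_norm, NNReal.coe_one, one_mul, ← map_sub]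
    exact W.norm_orthogonalProjectionOnto_apply_le _
  have hopen : IsOpen {w : W | x₀ + (w : E) ∈ interior K ∧ x + (w : E) ∈ Kᶜ} :=
    (isOpen_interior.preimage (by fun_prop)).inter (hc.isOpen_compl.preimage (by fun_prop))
  have hsub : (fun w : W => π x₀ + w) '' {w : W | x₀ + (w : E) ∈ interior K ∧ x + (w : E) ∈ Kᶜ}
      ⊆ π '' frontier K := by
    rintro _ ⟨w, ⟨hw1, hw2⟩, rfl⟩
    obtain ⟨z, hz, hzf⟩ : (segment ℝ (x₀ + (w : E)) (x + w) ∩ frontier K).Nonempty := by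
      by_contra hempty
      obtain ⟨z, -, hz1, hz2⟩ := (convex_segment (𝕜 := ℝ) (x₀ + (w : E)) (x + w)).isPreconnected
        (interior K) Kᶜ isOpen_interior hc.isOpen_compl (fun z hz => by
          by_contra h
          rw [Set.mem_union, not_or, Set.notMem_compl_iff] at h
          exact hempty ⟨z, hz, hc.frontier_eq ▸ ⟨h.2, h.1⟩⟩)
        ⟨_, left_mem_segment _ _ _, hw1⟩ ⟨_, right_mem_segment _ _ _, hw2⟩
      exact hz2 (interior_subset hz1)
    refine ⟨z, hzf, ?_⟩
    rw [segment_eq_image'] at hz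
    obtain ⟨t, -, rfl⟩ := hz
    have e1 : W.orthogonalProjectionOnto (x - x₀) = 0 :=
      Submodule.orthogonalProjectionOnto_eq_zero_iff.2
        (Submodule.le_orthogonal_orthogonal _ (Submodule.mem_span_singleton_self _))
    have e2 : x + (w : E) - (x₀ + w) = x - x₀ := by abel
    simp only [π, e2, map_add, map_smul, e1, smul_zero, add_zero,
      Submodule.orthogonalProjectionOnto_mem_subspace_eq_self]
  have hd : (finrank ℝ W : ENNReal) ≤ dimH (frontier K) := by
    refine le_trans ?_ (hπ.dimH_image_le _)
    refine le_trans (Eq.le ?_) (dimH_mono hsub)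
    rw [(isometry_add_left (π x₀)).dimH_image]
    refine (Real.dimH_of_nonempty_interior ⟨0, ?_⟩).symm
    rw [hopen.interior_eq]
    simpa using ⟨hx₀, hx⟩
  rw [← hfr]
  push_cast
  gcongr

/-- The displacement `x ↦ x - P x` from a closed convex set has divergence at least the
codimension of the boundary. -/
theorem IsMetricProjection.finrank_sub_dimH_le_trace {K : Set E} {P : E → E}
    (hP : IsMetricProjection K P) (hc : IsClosed K) (hK : Convex ℝ K) {x : E} (hx : x ∉ K)
    (hd : DifferentiableAt ℝ (fun y => y - P y) x) :
    (finrank ℝ E : ℝ) - (dimH (frontier K)).toReal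
      ≤ LinearMap.trace ℝ E (fderiv ℝ (fun y => y - P y) x : E →ₗ[ℝ] E) := by
  have hfin : dimH (frontier K) ≠ ⊤ := ne_top_of_le_ne_top (b := (finrank ℝ E : ENNReal))
    (by simp) ((dimH_mono (Set.subset_univ _)).trans (Real.dimH_univ_eq_finrank E).le)
  have hne : K.Nonempty := ⟨_, hP.mem x⟩
  have hdir : ∀ u : E, ∀ w : E, (∀ᶠ t : ℝ in 𝓝 0, (x + t • u) - P (x + t • u)
      = (x - P x) + t • w) → fderiv ℝ (fun y => y - P y) x u = w := by
    intro u w h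
    have h1 := hd.hasFDerivAt.hasLineDerivAt u
    have h2 : HasDerivAt (fun t : ℝ => (x - P x) + t • w) w 0 := by
      simpa using ((hasDerivAt_id (0 : ℝ)).smul_const w).const_add (x - P x)
    exact HasDerivAt.unique h1 (h2.congr_of_eventuallyEq h)
  have key : ∀ U : Submodule ℝ E, (∀ u ∈ U, fderiv ℝ (fun y => y - P y) x u = u) →
      (finrank ℝ E : ENNReal) ≤ dimH (frontier K) + finrank ℝ U →
      (finrank ℝ E : ℝ) - (dimH (frontier K)).toReal
        ≤ LinearMap.trace ℝ E (fderiv ℝ (fun y => y - P y) x : E →ₗ[ℝ] E) := by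
    intro U hU hdim
    have h1 := finrank_le_trace_of_eqOn (fderiv ℝ (fun y => y - P y) x : E →ₗ[ℝ] E)
      (fun u => hP.inner_fderiv_nonneg hd u) U hU
    have h2 := ENNReal.toReal_mono (by finiteness) hdim
    rw [ENNReal.toReal_add hfin (by simp)] at h2
    simp only [ENNReal.toReal_natCast] at h2
    linarith
  -- If K has interior, the frontier has dimension at least d - 1 and the normal direction alone
  -- suffices as U.
  by_cases htop : affineSpan ℝ K = ⊤
  · have hi := hK.interior_nonempty_iff_affineSpan_eq_top.2 htop
    have hv : x - P x ≠ 0 := norm_pos_iff.1 (hP.norm_sub_pos hx)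
    refine key (ℝ ∙ (x - P x)) (fun u hu => ?_) ?_
    · obtain ⟨a, rfl⟩ := Submodule.mem_span_singleton.1 hu
      rw [map_smul]
      congr 1
      refine hdir _ _ ?_
      filter_upwards [lt_mem_nhds (show (-1 : ℝ) < 0 by norm_num)] with t ht
      rw [hP.add_smul_sub x (by linarith)]
      abel
    · rw [finrank_span_singleton hv]
      simpa using finrank_le_dimH_frontier_add_one hi hc hx
  -- If K is flat, it equals its frontier, and v is affine with derivative the identity along all
  -- directions orthogonal to the affine span.
  · have hi : interior K = ∅ := by
      by_contra h
      exact htop (hK.interior_nonempty_iff_affineSpan_eq_top.1 (Set.nonempty_iff_ne_empty.2 h))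
    have hf : frontier K = K := by rw [hc.frontier_eq, hi, Set.sdiff_empty]
    refine key (affineSpan ℝ K).directionᗮ (fun u hu => hdir _ _ (Eventually.of_forall fun t => ?_))
      ?_
    · rw [hP.add_orthogonal x]
      · abel
      · intro y hy z hz
        rw [real_inner_smul_left, real_inner_comm, (Submodule.mem_orthogonal _ _).1 hu (y - z)
          (AffineSubspace.vsub_mem_direction (subset_affineSpan ℝ K hy)
            (subset_affineSpan ℝ K hz)), mul_zero]
    · rw [hf, ← Submodule.finrank_add_finrank_orthogonal (affineSpan ℝ K).direction]
      push_cast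
      gcongr
      exact hK.finrank_direction_le_dimH hne

end FrontierDimension

/-! ### The divergence bound in integrated form. -/

section WeakDivergence

variable {d : ℕ} {K : Set (EuclideanSpace ℝ (Fin d))}
  {P : EuclideanSpace ℝ (Fin d) → EuclideanSpace ℝ (Fin d)}

theorem IsMetricProjection.mul_integral_le_neg_integral_sum (hP : IsMetricProjection K P)
    (hc : IsClosed K) (hK : Convex ℝ K) {ψ : EuclideanSpace ℝ (Fin d) → ℝ} (hψ : ContDiff ℝ 1 ψ)
    (hψc : HasCompactSupport ψ) (hψs : tsupport ψ ⊆ Kᶜ) (hψ0 : ∀ x, 0 ≤ ψ x) :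
    ((d : ℝ) - (dimH (frontier K)).toReal) * ∫ x, ψ x ≤
      -∫ x, ∑ k, (x - P x) k * partialDeriv k ψ x := by
  let e : Fin d → EuclideanSpace ℝ (Fin d) := fun k => EuclideanSpace.single k 1
  obtain ⟨C, hC⟩ := hψ.lipschitzWith_of_hasCompactSupport hψc one_ne_zero
  have hv := hP.lipschitzWith_sub
  have hvk : ∀ k, LipschitzWith 1 (fun x => (x - P x) k) := fun k => by
    refine LipschitzWith.of_dist_le_mul fun x y => ?_
    refine le_trans ?_ (hv.dist_le_mul x y)
    rw [dist_eq_norm, dist_eq_norm, ← PiLp.sub_apply]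
    exact PiLp.norm_apply_le _ k
  have hint1 : ∀ k, Integrable (fun x => lineDeriv ℝ (fun x => (x - P x) k) x (e k) * ψ x) :=
    fun k => by
      simpa using ((hvk k).locallyIntegrable_lineDeriv (μ := volume) (e k)
        ).integrable_smul_right_of_hasCompactSupport hψ.continuous hψc
  have hint2 : ∀ k, Integrable (fun x => (x - P x) k * partialDeriv k ψ x) := fun k => by
    refine Continuous.integrable_of_hasCompactSupport ?_ ?_
    · exact (hvk k).continuous.mul ((hψ.continuous_fderiv one_ne_zero).clm_apply continuous_const)
    · exact (hψc.fderiv_apply ℝ (e k)).mul_left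
  have hparts : ∀ k, -∫ x, (x - P x) k * partialDeriv k ψ x
      = ∫ x, lineDeriv ℝ (fun x => (x - P x) k) x (e k) * ψ x := fun k => by
    rw [(hvk k).integral_lineDeriv_mul_eq hC hψc, ← integral_neg]
    refine integral_congr_ae (Eventually.of_forall fun x => ?_)
    simp only
    rw [(hψ.differentiable one_ne_zero x).lineDeriv_eq_fderiv, map_neg, partialDeriv]
    ring
  rw [integral_finsetSum _ fun k _ => hint2 k, ← Finset.sum_neg_distrib,
    Finset.sum_congr rfl fun k _ => hparts k, ← integral_finsetSum _ fun k _ => hint1 k,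
    ← integral_const_mul]
  refine integral_mono_ae ((hψ.continuous.integrable_of_hasCompactSupport hψc).const_mul _)
    (integrable_finsetSum _ fun k _ => hint1 k) ?_
  -- By Rademacher's theorem the pointwise trace bound is available almost everywhere. The
  -- integration by parts above needs only Lipschitz components.
  filter_upwards [hv.ae_differentiableAt (μ := volume)] with x hx
  rw [← Finset.sum_mul]
  by_cases hxK : x ∈ K
  · have : ψ x = 0 := image_eq_zero_of_notMem_tsupport fun h => hψs h hxK
    simp [this]
  refine mul_le_mul_of_nonneg_right ?_ (hψ0 x)
  have htr := hP.finrank_sub_dimH_le_trace hc hK hxK hx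
  rw [finrank_euclideanSpace_fin] at htr
  refine htr.trans (Eq.le ?_)
  rw [LinearMap.trace_eq_sum_inner _ (EuclideanSpace.basisFun (Fin d) ℝ)]
  refine Finset.sum_congr rfl fun k _ => ?_
  have h1 : HasFDerivAt (fun x => (x - P x) k)
      ((EuclideanSpace.proj k : EuclideanSpace ℝ (Fin d) →L[ℝ] ℝ) ∘L
        fderiv ℝ (fun y => y - P y) x) x :=
    (EuclideanSpace.proj k : EuclideanSpace ℝ (Fin d) →L[ℝ] ℝ).hasFDerivAt.comp x hx.hasFDerivAt
  rw [(h1.hasLineDerivAt (e k)).lineDeriv]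
  simp [e, EuclideanSpace.inner_single_left]

end WeakDivergence

section CompactlySupported

variable {E : Type*} [NormedAddCommGroup E] [NormedSpace ℝ E]

/-- This allows weights that are singular at the boundary: a factor supported inside Ω removes the
singularity. -/
theorem ContDiffOn.mul_of_tsupport_subset {Ω : Set E} {w u : E → ℝ} {n : WithTop ℕ∞}
    (hw : ContDiffOn ℝ n w Ω) (hΩ : IsOpen Ω) (hu : ContDiff ℝ n u) (hs : tsupport u ⊆ Ω) :
    ContDiff ℝ n (fun x => w x * u x) := by
  rw [contDiff_iff_contDiffAt]
  intro x
  by_cases hx : x ∈ tsupport u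
  · exact (hw.contDiffAt (hΩ.mem_nhds (hs hx))).mul hu.contDiffAt
  · refine contDiffAt_const (c := (0 : ℝ)) |>.congr_of_eventuallyEq ?_
    filter_upwards [(isClosed_tsupport u).isOpen_compl.mem_nhds hx] with y hy
    rw [image_eq_zero_of_notMem_tsupport hy, mul_zero]

end CompactlySupported

/-! ### One-variable calculus of the weight and the constant. -/

section Profile

/-- The logarithmic derivative `s c'(s) / c(s)` of the weight profile. -/
noncomputable def profileExponent (δ δ' s : ℝ) : ℝ := δ + (δ' - δ) * (s / (1 + s))

/-- The ratio `c(s) / s²` of the weight profile to the squared distance. -/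
noncomputable def profileRatio (δ δ' s : ℝ) : ℝ := weightProfile δ δ' s / s ^ 2

/-- The radial factor `h(s)` of the comparison field `h(d_Γ) ∇(d_Γ² / 2)`. -/
noncomputable def fieldProfile (p τ δ δ' s : ℝ) : ℝ :=
  (p - 1) * (profileRatio δ δ' s ^ p * (2 - profileExponent δ δ' s + 2 * τ))

variable {δ δ' s : ℝ}

theorem weightProfile_pos (hs : 0 < s) : 0 < weightProfile δ δ' s := by
  unfold weightProfile; positivity

theorem profileRatio_pos (hs : 0 < s) : 0 < profileRatio δ δ' s :=
  div_pos (weightProfile_pos hs) (by positivity)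

theorem weightProfile_eq (hs : 0 < s) : weightProfile δ δ' s = profileRatio δ δ' s * s ^ 2 := by
  unfold profileRatio; field_simp

theorem contDiffAt_weightProfile {n : WithTop ℕ∞} (hs : 0 < s) :
    ContDiffAt ℝ n (weightProfile δ δ') s := by
  unfold weightProfile
  exact (contDiffAt_id.rpow_const_of_ne hs.ne').mul
    ((contDiffAt_const.add contDiffAt_id).rpow_const_of_ne (by simp; linarith))

theorem contDiffAt_profileRatio {n : WithTop ℕ∞} (hs : 0 < s) :
    ContDiffAt ℝ n (profileRatio δ δ') s :=
  (contDiffAt_weightProfile hs).div (contDiffAt_id.pow 2) (by simpa using hs.ne')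

theorem contDiffAt_profileRatio_rpow {n : WithTop ℕ∞} (hs : 0 < s) (q : ℝ) :
    ContDiffAt ℝ n (fun s => profileRatio δ δ' s ^ q) s :=
  (contDiffAt_profileRatio hs).rpow_const_of_ne (profileRatio_pos hs).ne'

theorem contDiffAt_profileExponent {n : WithTop ℕ∞} (hs : 0 < s) :
    ContDiffAt ℝ n (profileExponent δ δ') s :=
  contDiffAt_const.add (contDiffAt_const.mul (contDiffAt_id.div
    (contDiffAt_const.add contDiffAt_id) (by simp; linarith)))

theorem contDiffAt_fieldProfile {n : WithTop ℕ∞} (p τ : ℝ) (hs : 0 < s) :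
    ContDiffAt ℝ n (fieldProfile p τ δ δ') s :=
  contDiffAt_const.mul ((contDiffAt_profileRatio_rpow hs p).mul
    ((contDiffAt_const.sub (contDiffAt_profileExponent hs)).add contDiffAt_const))

theorem hasDerivAt_profileRatio (hs : 0 < s) :
    HasDerivAt (profileRatio δ δ')
      (profileRatio δ δ' s * (profileExponent δ δ' s - 2) / s) s := by
  have h1 : 0 < 1 + s := by linarith
  have h := (((hasDerivAt_id s).rpow_const (p := δ) (Or.inl hs.ne')).mul
    (((hasDerivAt_id s).const_add 1).rpow_const (p := δ' - δ) (Or.inl h1.ne'))).div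
      ((hasDerivAt_id s).pow 2) (by simpa using hs.ne')
  refine h.congr_deriv ?_
  simp only [id, profileRatio, profileExponent, weightProfile, Pi.mul_apply, Pi.pow_apply]
  rw [Real.rpow_sub_one hs.ne', Real.rpow_sub_one h1.ne']
  field_simp
  ring

theorem hasDerivAt_profileRatio_rpow (hs : 0 < s) (q : ℝ) :
    HasDerivAt (fun s => profileRatio δ δ' s ^ q)
      (q * profileRatio δ δ' s ^ q * (profileExponent δ δ' s - 2) / s) s := by
  refine ((hasDerivAt_profileRatio hs).rpow_const (p := q)
    (Or.inl (profileRatio_pos hs).ne')).congr_deriv ?_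
  rw [Real.rpow_sub_one (profileRatio_pos hs).ne']
  have := (profileRatio_pos (δ := δ) (δ' := δ') hs).ne'
  field_simp

theorem hasDerivAt_profileExponent (hs : 0 < s) :
    HasDerivAt (profileExponent δ δ') ((δ' - δ) / (1 + s) ^ 2) s := by
  have h1 : 1 + s ≠ 0 := by linarith
  refine ((((hasDerivAt_id s).div ((hasDerivAt_id s).const_add 1) h1).const_mul
    (δ' - δ)).const_add δ).congr_deriv ?_
  simp only [id]
  field_simp
  ring

theorem hasDerivAt_fieldProfile (p τ : ℝ) (hs : 0 < s) :
    HasDerivAt (fieldProfile p τ δ δ')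
      ((p - 1) * (profileRatio δ δ' s ^ p * (p * (profileExponent δ δ' s - 2)
        * (2 - profileExponent δ δ' s + 2 * τ) - (δ' - δ) * s / (1 + s) ^ 2)) / s) s := by
  refine (((hasDerivAt_profileRatio_rpow hs p).mul
    (((hasDerivAt_profileExponent hs).const_sub 2).add_const (2 * τ))).const_mul
      (p - 1)).congr_deriv ?_
  field_simp
  ring

theorem profileExponent_mem_Icc (hs : 0 < s) :
    profileExponent δ δ' s ∈ Set.Icc (min δ δ') (max δ δ') := by
  have h0 : 0 ≤ s / (1 + s) := by positivity
  have h1 : s / (1 + s) ≤ 1 := by rw [div_le_one (by positivity)]; linarith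
  unfold profileExponent
  rcases le_total δ δ' with h | h
  · rw [min_eq_left h, max_eq_right h]; constructor <;> nlinarith
  · rw [min_eq_right h, max_eq_left h]; constructor <;> nlinarith

/-- The bound s/(1+s)² ≤ 1/4 is the source of |δ - δ'|/4 in the constant. -/
theorem mul_div_one_add_sq_le (hs : 0 < s) :
    (δ' - δ) * s / (1 + s) ^ 2 ≤ |δ - δ'| / 4 := by
  rw [div_le_div_iff₀ (by positivity) (by norm_num), abs_sub_comm]
  nlinarith [le_abs_self (δ' - δ), abs_nonneg (δ' - δ), sq_nonneg (1 - s),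
    mul_nonneg (abs_nonneg (δ' - δ)) (sq_nonneg (1 - s))]

/-- The constant in the weighted Rellich inequality, where `N` is the codimension of the
boundary. -/
noncomputable def weightedRellichConst (N p δ δ' : ℝ) : ℝ :=
  (p - 1) / p * ((N + p * min δ δ' - 2 * p) ^ 2 / p
    + (2 - max δ δ') * (N + p * min δ δ' - 2 * p) - |δ - δ'| / 4)

/-- The condition gives (2 - δ∨δ')A ≥ 2p|δ - δ'| with A = N + p(δ∧δ') - 2p, which absorbs |δ -
δ'|/4. The term A²/p supplies strictness. -/
theorem weightedRellichConst_pos {N p : ℝ} (hp : 1 < p) (hmax : max δ δ' < 2)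
    (hcond : 2 * p * |δ - δ'| * (2 - max δ δ')⁻¹ ≤ N + p * min δ δ' - 2 * p)
    (hpos : 0 < N + p * min δ δ' - 2 * p) : 0 < weightedRellichConst N p δ δ' := by
  have h2 : 0 < 2 - max δ δ' := by linarith
  rw [← div_eq_mul_inv, div_le_iff₀ h2] at hcond
  have h3 : 0 < (N + p * min δ δ' - 2 * p) ^ 2 / p := by positivity
  refine mul_pos (div_pos (by linarith) (by linarith)) ?_
  nlinarith [mul_nonneg (sub_nonneg.2 hp.le) (abs_nonneg (δ - δ')), abs_nonneg (δ - δ')]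

theorem weightedRellichConst_le (d : ℕ) {dH p : ℝ} (hp : 1 < p)
    (hpos : 0 < (d : ℝ) - dH + p * min δ δ' - 2 * p) :
    weightedRellichConst (d - dH) p δ δ' ≤ rellichConst d dH p δ δ' := by
  unfold weightedRellichConst rellichConst
  set A := (d : ℝ) - dH + p * min δ δ' - 2 * p with hA
  have hN : (d : ℝ) - dH = A + p * (2 - min δ δ') := by rw [hA]; ring
  have e : (p - 1) * ((d : ℝ) - dH) * A / p ^ 2
      = (p - 1) / p * (A ^ 2 / p + (2 - min δ δ') * A) := by
    rw [hN]; field_simp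
  rw [e]
  have h1 : (2 - max δ δ') * A ≤ (2 - min δ δ') * A :=
    mul_le_mul_of_nonneg_right (by linarith [min_le_max (a := δ) (b := δ')]) hpos.le
  refine mul_le_mul_of_nonneg_left ?_ (div_nonneg (by linarith) (by linarith))
  linarith [abs_nonneg (δ - δ')]

theorem weightedRellichConst_self (d : ℕ) {dH p : ℝ} (hp : 1 < p) (δ : ℝ) :
    weightedRellichConst (d - dH) p δ δ = rellichConst d dH p δ δ := by
  unfold weightedRellichConst rellichConst
  simp only [min_self, max_self, sub_self, abs_zero]
  have : p ≠ 0 := by linarith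
  field_simp
  ring

/-- The comparison field has sufficiently large weighted divergence. -/
theorem weightedRellichConst_mul_le_fieldProfile {N p τ : ℝ} (hp : 1 < p)
    (hmax : max δ δ' < 2) (hpos : 0 < N + p * min δ δ' - 2 * p)
    (hτ : τ = (N + p * min δ δ' - 2 * p) / p) (hs : 0 < s) :
    p * weightedRellichConst N p δ δ' * profileRatio δ δ' s ^ p ≤
      N * fieldProfile p τ δ δ' s + s * deriv (fieldProfile p τ δ δ') s
        - p * (p - 1) * τ ^ 2 * profileRatio δ δ' s ^ p := by
  rw [(hasDerivAt_fieldProfile p τ hs).deriv]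
  unfold fieldProfile weightedRellichConst
  set A := N + p * min δ δ' - 2 * p with hA
  set e := profileExponent δ δ' s with he
  have hp0 : 0 < p := by linarith
  obtain ⟨he1, he2⟩ := profileExponent_mem_Icc (δ := δ) (δ' := δ') hs
  rw [← he] at he1 he2
  have hk := mul_div_one_add_sq_le (δ := δ) (δ' := δ') hs
  set κ := (δ' - δ) * s / (1 + s) ^ 2
  have hb := Real.rpow_pos_of_pos (profileRatio_pos (δ := δ) (δ' := δ') hs) p
  set b := profileRatio δ δ' s ^ p
  have hτp : A = p * τ := by rw [hτ]; field_simp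
  have hτ0 : 0 < τ := by rw [hτ]; positivity
  have hae : A ≤ N + p * (e - 2) := by rw [hA]; nlinarith
  -- The two factors are minimized separately, at e = δ∨δ' and at e = δ∧δ'. This loses nothing when
  -- δ = δ'.
  have h1 : (2 - max δ δ' + 2 * τ) * A ≤ (2 - e + 2 * τ) * (N + p * (e - 2)) :=
    mul_le_mul (by linarith) hae hpos.le (by linarith)
  -- The value τ = A/p maximizes 2τA - pτ².
  have hAA : A ^ 2 / p = 2 * τ * A - p * τ ^ 2 := by rw [hτp]; field_simp; ring
  have h2 : A ^ 2 / p + (2 - max δ δ') * A - |δ - δ'| / 4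
      ≤ (2 - e + 2 * τ) * (N + p * (e - 2)) - κ - p * τ ^ 2 := by
    rw [hAA]; linarith
  have h3 := mul_le_mul_of_nonneg_left h2 (mul_nonneg (sub_nonneg.2 hp.le) hb.le)
  refine le_trans (Eq.le ?_) (h3.trans (Eq.le ?_))
  · field_simp
  · field_simp
    ring

end Profile

/-! ### Smooth substitutes for |y|^(p-2)y and |y|^p/p. -/

section RegularizedPower

/-- A smooth approximation of `|y|^(p-2) y`. -/
noncomputable def regPower (p ε y : ℝ) : ℝ := y * (y ^ 2 + ε) ^ (p / 2 - 1)

/-- The primitive of `regPower` vanishing at the origin. -/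
noncomputable def regPrimitive (p ε y : ℝ) : ℝ := ((y ^ 2 + ε) ^ (p / 2) - ε ^ (p / 2)) / p

variable {p ε : ℝ}

theorem regPower_zero : regPower p ε 0 = 0 := by simp [regPower]

theorem regPrimitive_zero : regPrimitive p ε 0 = 0 := by simp [regPrimitive]

theorem regPrimitive_nonneg (hp : 0 < p) (hε : 0 < ε) (y : ℝ) : 0 ≤ regPrimitive p ε y := by
  refine div_nonneg (sub_nonneg.2 (Real.rpow_le_rpow hε.le ?_ (by positivity))) hp.le
  nlinarith [sq_nonneg y]

theorem contDiff_regPower {n : WithTop ℕ∞} (hε : 0 < ε) : ContDiff ℝ n (regPower p ε) :=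
  contDiff_id.mul (((contDiff_id.pow 2).add contDiff_const).rpow_const_of_ne
    fun y => by simp only [id]; positivity)

theorem contDiff_regPrimitive {n : WithTop ℕ∞} (hε : 0 < ε) :
    ContDiff ℝ n (regPrimitive p ε) :=
  ((((contDiff_id.pow 2).add contDiff_const).rpow_const_of_ne
    fun y => by simp only [id]; positivity).sub contDiff_const).div_const p

theorem hasDerivAt_regPower (hε : 0 < ε) (y : ℝ) :
    HasDerivAt (regPower p ε)
      ((y ^ 2 + ε) ^ (p / 2 - 2) * ((p - 1) * y ^ 2 + ε)) y := by
  have h0 : 0 < y ^ 2 + ε := by positivity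
  refine ((hasDerivAt_id y).mul ((((hasDerivAt_id y).pow 2).add_const ε).rpow_const
    (p := p / 2 - 1) (Or.inl h0.ne'))).congr_deriv ?_
  simp only [id, Pi.pow_apply]
  have e : (y ^ 2 + ε) ^ (p / 2 - 1) = (y ^ 2 + ε) ^ (p / 2 - 2) * (y ^ 2 + ε) := by
    rw [← Real.rpow_add_one h0.ne']; ring_nf
  have e2 : p / 2 - 1 - 1 = p / 2 - 2 := by ring
  rw [e2, e]
  push_cast
  ring

theorem hasDerivAt_regPrimitive (hp : 0 < p) (hε : 0 < ε) (y : ℝ) :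
    HasDerivAt (regPrimitive p ε) (regPower p ε y) y := by
  have h0 : 0 < y ^ 2 + ε := by positivity
  refine ((((((hasDerivAt_id y).pow 2).add_const ε).rpow_const
    (p := p / 2) (Or.inl h0.ne')).sub_const (ε ^ (p / 2))).div_const p).congr_deriv ?_
  simp only [id, Pi.pow_apply, regPower]
  push_cast
  field_simp

theorem abs_regPower_le (hε : 0 < ε) (y : ℝ) :
    |regPower p ε y| ≤ (y ^ 2 + ε) ^ ((p - 1) / 2) := by
  have h0 : 0 < y ^ 2 + ε := by positivity
  have hy : |y| ≤ (y ^ 2 + ε) ^ (1 / 2 : ℝ) := by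
    rw [← Real.sqrt_eq_rpow]; exact Real.abs_le_sqrt (by linarith)
  rw [regPower, abs_mul, abs_of_pos (Real.rpow_pos_of_pos h0 _)]
  refine (mul_le_mul_of_nonneg_right hy (Real.rpow_nonneg h0.le _)).trans (Eq.le ?_)
  rw [← Real.rpow_add h0]
  ring_nf

/-- The completion of the square behind the weighted Hardy inequality. -/
theorem neg_le_mul_deriv_regPower {D Q R τ y : ℝ} (hp : 1 < p) (hε : 0 < ε)
    (hcs : R ^ 2 ≤ D ^ 2 * Q) :
    -(p - 1) * (2 * τ * regPower p ε y * R + τ ^ 2 * (y ^ 2 + ε) ^ (p / 2))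
      ≤ D ^ 2 * ((y ^ 2 + ε) ^ (p / 2 - 2) * ((p - 1) * y ^ 2 + ε)) * Q := by
  have h0 : 0 < y ^ 2 + ε := by positivity
  unfold regPower
  have e1 : (y ^ 2 + ε) ^ (p / 2 - 1) = (y ^ 2 + ε) ^ (p / 2 - 2) * (y ^ 2 + ε) := by
    rw [← Real.rpow_add_one h0.ne']; ring_nf
  have e2 : (y ^ 2 + ε) ^ (p / 2) = (y ^ 2 + ε) ^ (p / 2 - 2) * (y ^ 2 + ε) ^ 2 := by
    rw [← Real.rpow_natCast (y ^ 2 + ε) 2, ← Real.rpow_add h0]; congr 1; push_cast; ring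
  rw [e1, e2]
  have hb := Real.rpow_pos_of_pos h0 (p / 2 - 2)
  set b := (y ^ 2 + ε) ^ (p / 2 - 2)
  set r := y ^ 2 + ε
  have h1 : ((p - 1) * y ^ 2 + ε) * R ^ 2 ≤ ((p - 1) * y ^ 2 + ε) * (D ^ 2 * Q) :=
    mul_le_mul_of_nonneg_left hcs (by nlinarith [sq_nonneg y])
  -- With r = y² + ε, this square and εR² together make up ((p-1)y² + ε)R² + (p-1)(2τyrR + τ²r²).
  have h2 : 0 ≤ (p - 1) * (y * R + τ * r) ^ 2 := by
    have := sub_pos.2 hp; positivity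
  have h3 : 0 ≤ ε * R ^ 2 := by positivity
  have h4 : 0 ≤ b * (((p - 1) * y ^ 2 + ε) * (D ^ 2 * Q)
      + (p - 1) * (2 * τ * y * r * R + τ ^ 2 * r ^ 2)) := by
    refine mul_nonneg hb.le ?_
    nlinarith
  nlinarith

end RegularizedPower

/-! ### Passage to the limit in ε, and duality. -/

section Integrals

theorem ContinuousOn.memLp_restrict_of_isCompact {X : Type*} [TopologicalSpace X]
    [T2Space X] [MeasurableSpace X] [OpensMeasurableSpace X] {μ : Measure X}
    [IsFiniteMeasureOnCompacts μ] {S : Set X} (hS : IsCompact S) {f : X → ℝ}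
    (hf : ContinuousOn f S) (q : ENNReal) : MemLp f q (μ.restrict S) := by
  have : IsFiniteMeasure (μ.restrict S) := ⟨by simpa using hS.measure_lt_top⟩
  obtain ⟨C, hC⟩ := hS.exists_bound_of_continuousOn hf
  exact MemLp.of_bound (hf.aestronglyMeasurable_of_isCompact hS hS.measurableSet) C
    ((ae_restrict_iff' hS.measurableSet).2 (Eventually.of_forall hC))

theorem tendsto_setIntegral_mul_sq_add_rpow {X : Type*} [TopologicalSpace X]
    [T2Space X] [MeasurableSpace X] [OpensMeasurableSpace X] {μ : Measure X}
    [IsFiniteMeasureOnCompacts μ] {S : Set X} (hS : IsCompact S) {w u : X → ℝ}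
    (hw : ContinuousOn w S) (hu : ContinuousOn u S) {a : ℝ} (ha : 0 < a) :
    Tendsto (fun ε : ℝ => ∫ x in S, w x * (u x ^ 2 + ε) ^ a ∂μ) (𝓝[>] 0)
      (𝓝 (∫ x in S, w x * |u x| ^ (2 * a) ∂μ)) := by
  have hcont : ∀ ε : ℝ, ContinuousOn (fun x => w x * (u x ^ 2 + ε) ^ a) S := fun ε =>
    hw.mul (((hu.pow 2).add continuousOn_const).rpow_const fun _ _ => Or.inr ha.le)
  refine tendsto_integral_filter_of_dominated_convergence
    (fun x => ‖w x * (u x ^ 2 + 1) ^ a‖) ?_ ?_ ?_ ?_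
  · exact Eventually.of_forall fun ε =>
      ((hcont ε).memLp_restrict_of_isCompact hS 1).aestronglyMeasurable
  · filter_upwards [Ioo_mem_nhdsGT (show (0 : ℝ) < 1 by norm_num)] with ε hε
    refine Eventually.of_forall fun x => ?_
    rw [norm_mul, norm_mul]
    refine mul_le_mul_of_nonneg_left ?_ (norm_nonneg _)
    have h1 : 0 ≤ u x ^ 2 + ε := add_nonneg (sq_nonneg _) hε.1.le
    rw [Real.norm_of_nonneg (by positivity), Real.norm_of_nonneg (by positivity)]
    exact Real.rpow_le_rpow h1 (by linarith [hε.2]) ha.le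
  · exact (memLp_one_iff_integrable.1 ((hcont 1).memLp_restrict_of_isCompact hS 1)).norm
  · refine Eventually.of_forall fun x => ?_
    have e : |u x| ^ (2 * a) = (u x ^ 2 + 0) ^ a := by
      rw [Real.rpow_mul (abs_nonneg _), add_zero, Real.rpow_two, sq_abs]
    rw [e]
    refine Tendsto.mono_left ?_ nhdsWithin_le_nhds
    exact tendsto_const_nhds.mul ((tendsto_const_nhds.add tendsto_id).rpow_const (Or.inr ha.le))

/-- A duality estimate: testing against `u^(p-1)` bounds the `L^p` norm of `u`. -/
theorem rpow_mul_integral_rpow_le_of_le_integral_mul {α : Type*} [MeasurableSpace α]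
    {μ : Measure α} {p c : ℝ} (hp : 1 < p) (hc : 0 ≤ c) {f u : α → ℝ} (hf0 : 0 ≤ f) (hu0 : 0 ≤ u)
    (hf : MemLp f (ENNReal.ofReal p) μ)
    (hu : MemLp (fun x => u x ^ (p - 1)) (ENNReal.ofReal (p / (p - 1))) μ)
    (h : c * ∫ x, u x ^ p ∂μ ≤ ∫ x, f x * u x ^ (p - 1) ∂μ) :
    c ^ p * ∫ x, u x ^ p ∂μ ≤ ∫ x, f x ^ p ∂μ := by
  have hp1 : 0 < p - 1 := by linarith
  have hp0 : 0 < p := by linarith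
  have hpq : p.HolderConjugate (p / (p - 1)) := Real.HolderConjugate.conjExponent hp
  have hH := integral_mul_le_Lp_mul_Lq_of_nonneg hpq (Eventually.of_forall hf0)
    (Eventually.of_forall fun x => Real.rpow_nonneg (hu0 x) _) hf hu
  have e : ∀ x, (u x ^ (p - 1)) ^ (p / (p - 1)) = u x ^ p := fun x => by
    rw [← Real.rpow_mul (hu0 x)]; congr 1; field_simp
  simp only [e] at hH
  set X := ∫ x, u x ^ p ∂μ with hX
  set Y := ∫ x, f x ^ p ∂μ with hY
  have hX0 : 0 ≤ X := integral_nonneg fun x => Real.rpow_nonneg (hu0 x) _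
  have hY0 : 0 ≤ Y := integral_nonneg fun x => Real.rpow_nonneg (hf0 x) _
  rcases hX0.eq_or_lt with h0 | h0
  · rw [← h0, mul_zero]; exact hY0
  -- Hölder gives cX ≤ Y^(1/p) X^((p-1)/p). Taking p-th powers and cancelling X^(p-1) needs X > 0.
  have h1 : c * X ≤ Y ^ (1 / p) * X ^ (1 / (p / (p - 1))) := h.trans hH
  have h2 := Real.rpow_le_rpow (by positivity) h1 hp0.le
  rw [Real.mul_rpow hc hX0, Real.mul_rpow (by positivity) (by positivity), ← Real.rpow_mul hY0,
    ← Real.rpow_mul hX0, one_div_mul_cancel hp0.ne', Real.rpow_one] at h2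
  have e2 : 1 / (p / (p - 1)) * p = p - 1 := by field_simp
  rw [e2, Real.rpow_sub_one h0.ne'] at h2
  have hXp := Real.rpow_pos_of_pos h0 p
  rw [← mul_div_assoc, le_div_iff₀ h0] at h2
  exact le_of_mul_le_mul_right (by linarith) hXp

end Integrals

/-! ### Pointwise comparison of the energy with the divergence of the field. -/

section Pointwise

variable {d : ℕ} {K : Set (EuclideanSpace ℝ (Fin d))}
  {P : EuclideanSpace ℝ (Fin d) → EuclideanSpace ℝ (Fin d)}

theorem IsMetricProjection.partialDeriv_comp_mul_comp (hP : IsMetricProjection K P)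
    {x : EuclideanSpace ℝ (Fin d)} (hx : x ∈ Kᶜ) {φ : EuclideanSpace ℝ (Fin d) → ℝ}
    (hφ : DifferentiableAt ℝ φ x) {w G : ℝ → ℝ} {w' G' : ℝ}
    (hw : HasDerivAt w w' ‖x - P x‖) (hG : HasDerivAt G G' (φ x)) (k : Fin d) :
    partialDeriv k (fun y => w ‖y - P y‖ * G (φ y)) x =
      w ‖x - P x‖ * (G' * partialDeriv k φ x)
        + G (φ x) * (w' * ((x - P x) k / ‖x - P x‖)) := by
  have h := (hw.comp_hasFDerivAt x (hP.hasFDerivAt_norm_sub hx)).mul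
    (hG.comp_hasFDerivAt x hφ.hasFDerivAt)
  unfold partialDeriv
  have h' : fderiv ℝ (fun y => w ‖y - P y‖ * G (φ y)) x = _ := h.fderiv
  rw [h']
  simp [EuclideanSpace.inner_single_right, div_eq_inv_mul]

theorem sq_sum_mul_le_norm_sq_mul (v : EuclideanSpace ℝ (Fin d)) (q : Fin d → ℝ) :
    (∑ k, v k * q k) ^ 2 ≤ ‖v‖ ^ 2 * ∑ k, q k ^ 2 := by
  rw [EuclideanSpace.real_norm_sq_eq]
  exact Finset.sum_mul_sq_le_sq_mul_sq _ _ _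

/-- The pointwise comparison between the energy density of `φ` and the divergence of the
comparison field. -/
theorem IsMetricProjection.energy_density_ge (hP : IsMetricProjection K P)
    {x : EuclideanSpace ℝ (Fin d)} (hx : x ∈ Kᶜ) {φ : EuclideanSpace ℝ (Fin d) → ℝ}
    (hφ : DifferentiableAt ℝ φ x) {N p τ δ δ' ε : ℝ} (hp : 1 < p) (hε : 0 < ε)
    (hmax : max δ δ' < 2) (hpos : 0 < N + p * min δ δ' - 2 * p)
    (hτ : τ = (N + p * min δ δ' - 2 * p) / p) :
    profileRatio δ δ' ‖x - P x‖ ^ p * (weightedRellichConst N p δ δ' *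
        ((φ x ^ 2 + ε) ^ (p / 2) - ε ^ (p / 2)) - (p - 1) * τ ^ 2 * ε ^ (p / 2)) ≤
      (∑ k, weightProfile δ δ' ‖x - P x‖ * partialDeriv k φ x * partialDeriv k
        (fun y => profileRatio δ δ' ‖y - P y‖ ^ (p - 1) * regPower p ε (φ y)) x)
      + ((∑ k, (x - P x) k * partialDeriv k
        (fun y => fieldProfile p τ δ δ' ‖y - P y‖ * regPrimitive p ε (φ y)) x)
      + N * (fieldProfile p τ δ δ' ‖x - P x‖ * regPrimitive p ε (φ x))) := by
  have hD := hP.norm_sub_pos hx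
  have hp0 : 0 < p := by linarith
  have hcoer := weightedRellichConst_mul_le_fieldProfile hp hmax hpos hτ hD
  have hcs := sq_sum_mul_le_norm_sq_mul (x - P x) (fun k => partialDeriv k φ x)
  have hsq := neg_le_mul_deriv_regPower (τ := τ) (y := φ x) hp hε hcs
  have hΦ := regPrimitive_nonneg hp0 hε (φ x)
  have hη := hP.partialDeriv_comp_mul_comp hx hφ
    (hasDerivAt_profileRatio_rpow (δ := δ) (δ' := δ') hD (p - 1))
    (hasDerivAt_regPower (p := p) hε (φ x))
  have hψ := hP.partialDeriv_comp_mul_comp hx hφ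
    (((contDiffAt_fieldProfile (n := 1) (δ := δ) (δ' := δ') p τ hD).differentiableAt
      one_ne_zero).hasDerivAt) (hasDerivAt_regPrimitive hp0 hε (φ x))
  simp only [hη, hψ]
  have hΦe : p * regPrimitive p ε (φ x) = (φ x ^ 2 + ε) ^ (p / 2) - ε ^ (p / 2) := by
    unfold regPrimitive; field_simp
  rw [weightProfile_eq hD]
  have hvv : ∑ k, (x - P x) k ^ 2 = ‖x - P x‖ ^ 2 := (EuclideanSpace.real_norm_sq_eq _).symm
  have hb0 := profileRatio_pos (δ := δ) (δ' := δ') hD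
  have hbp : profileRatio δ δ' ‖x - P x‖ * profileRatio δ δ' ‖x - P x‖ ^ (p - 1)
      = profileRatio δ δ' ‖x - P x‖ ^ p := by
    rw [Real.rpow_sub_one hb0.ne']; field_simp
  have hfield : fieldProfile p τ δ δ' ‖x - P x‖ = (p - 1) *
    (profileRatio δ δ' ‖x - P x‖ ^ p * (2 - profileExponent δ δ' ‖x - P x‖ + 2 * τ)) := rfl
  have hb := Real.rpow_pos_of_pos hb0 p
  set h' := deriv (fieldProfile p τ δ δ') ‖x - P x‖
  set h := fieldProfile p τ δ δ' ‖x - P x‖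
  set e := profileExponent δ δ' ‖x - P x‖
  set b₁ := profileRatio δ δ' ‖x - P x‖ ^ (p - 1)
  set bp := profileRatio δ δ' ‖x - P x‖ ^ p
  set b := profileRatio δ δ' ‖x - P x‖
  set Φ := regPrimitive p ε (φ x)
  set G := regPower p ε (φ x)
  set G' := (φ x ^ 2 + ε) ^ (p / 2 - 2) * ((p - 1) * φ x ^ 2 + ε)
  set D := ‖x - P x‖
  set Q := ∑ k, partialDeriv k φ x ^ 2
  set R := ∑ k, (x - P x) k * partialDeriv k φ x
  set c := weightedRellichConst N p δ δ'
  -- The coefficient (p-1)(e-2) from differentiating the weight joins -2(p-1)τ from the square to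
  -- give exactly -h.
  have s1 : ∑ k, b * D ^ 2 * partialDeriv k φ x * (b₁ * (G' * partialDeriv k φ x)
      + G * ((p - 1) * b₁ * (e - 2) / D * ((x - P x) k / D)))
      = bp * (D ^ 2 * G' * Q) + bp * (p - 1) * (e - 2) * G * R := by
    rw [← hbp]
    simp only [Q, R, Finset.mul_sum, ← Finset.sum_add_distrib]
    refine Finset.sum_congr rfl fun k _ => ?_
    field_simp
  have s2 : ∑ k, (x - P x) k * (h * (G * partialDeriv k φ x)
      + Φ * (h' * ((x - P x) k / D))) = h * G * R + Φ * h' * D := by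
    have : Φ * h' * D = Φ * h' / D * D ^ 2 := by field_simp
    rw [this, ← hvv]
    simp only [R, Finset.mul_sum, ← Finset.sum_add_distrib]
    refine Finset.sum_congr rfl fun k _ => ?_
    ring
  rw [s1, s2, ← hΦe]
  have t1 := mul_le_mul_of_nonneg_left hsq hb.le
  have t2 := mul_le_mul_of_nonneg_left hcoer hΦ
  have hr : (φ x ^ 2 + ε) ^ (p / 2) = p * Φ + ε ^ (p / 2) := by rw [hΦe]; ring
  rw [hr] at t1
  rw [hfield] at t2 ⊢
  linarith

end Pointwise

/-! ### Integration by parts and the Rellich inequality. -/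

section Rellich

variable {d : ℕ} {K : Set (EuclideanSpace ℝ (Fin d))}
  {P : EuclideanSpace ℝ (Fin d) → EuclideanSpace ℝ (Fin d)}

theorem continuous_partialDeriv {f : EuclideanSpace ℝ (Fin d) → ℝ} (hf : ContDiff ℝ 1 f)
    (k : Fin d) : Continuous (partialDeriv k f) :=
  (hf.continuous_fderiv one_ne_zero).clm_apply continuous_const

theorem tsupport_partialDeriv_subset (f : EuclideanSpace ℝ (Fin d) → ℝ) (k : Fin d) :
    tsupport (partialDeriv k f) ⊆ tsupport f :=
  tsupport_fderiv_apply_subset ℝ (EuclideanSpace.single k 1)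

theorem contDiff_partialDeriv {f : EuclideanSpace ℝ (Fin d) → ℝ} (hf : ContDiff ℝ 2 f)
    (k : Fin d) : ContDiff ℝ 1 (partialDeriv k f) :=
  (hf.fderiv_right (m := 1) (by norm_num)).clm_apply contDiff_const

theorem IsMetricProjection.contDiffOn_comp_norm_sub (hP : IsMetricProjection K P)
    (hc : IsClosed K) {w : ℝ → ℝ} (hw : ∀ s, 0 < s → ContDiffAt ℝ 1 w s) :
    ContDiffOn ℝ 1 (fun x => w ‖x - P x‖) Kᶜ := fun x hx =>
  (hw _ (hP.norm_sub_pos hx)).comp_contDiffWithinAt x (hP.contDiffOn_norm_sub hc x hx)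

theorem IsMetricProjection.domainWeight_eq (hP : IsMetricProjection K P) (δ δ' : ℝ) :
    domainWeight δ δ' Kᶜ = fun x => weightProfile δ δ' ‖x - P x‖ := by
  funext x
  rw [domainWeight, boundaryDist, compl_compl, hP.infDist_eq]

variable {φ : EuclideanSpace ℝ (Fin d) → ℝ} {δ δ' : ℝ}

theorem IsMetricProjection.contDiff_flux (hP : IsMetricProjection K P) (hc : IsClosed K)
    (hφ : IsCc2 Kᶜ φ) (k : Fin d) :
    ContDiff ℝ 1 (fun x => weightProfile δ δ' ‖x - P x‖ * partialDeriv k φ x) :=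
  (hP.contDiffOn_comp_norm_sub hc fun _ hs => contDiffAt_weightProfile hs).mul_of_tsupport_subset
    hc.isOpen_compl (contDiff_partialDeriv hφ.contDiff k)
    ((tsupport_partialDeriv_subset φ k).trans hφ.tsupport_subset)

theorem tsupport_flux_subset (w φ : EuclideanSpace ℝ (Fin d) → ℝ) (k : Fin d) :
    tsupport (fun x => w x * partialDeriv k φ x) ⊆ tsupport φ :=
  tsupport_mul_subset_right.trans (tsupport_partialDeriv_subset φ k)

theorem divFormOp_eq_zero (w : EuclideanSpace ℝ (Fin d) → ℝ) {x : EuclideanSpace ℝ (Fin d)}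
    (hx : x ∉ tsupport φ) : divFormOp w φ x = 0 := by
  unfold divFormOp
  rw [neg_eq_zero]
  refine Finset.sum_eq_zero fun k _ => image_eq_zero_of_notMem_tsupport fun h => hx ?_
  exact tsupport_flux_subset w φ k (tsupport_partialDeriv_subset _ k h)

theorem IsMetricProjection.continuous_divFormOp (hP : IsMetricProjection K P) (hc : IsClosed K)
    (hφ : IsCc2 Kᶜ φ) :
    Continuous (divFormOp (fun x => weightProfile δ δ' ‖x - P x‖) φ) :=
  (continuous_finsetSum _ fun k _ => continuous_partialDeriv (hP.contDiff_flux hc hφ k) k).neg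

/-- Integration by parts: `∫ (Hφ) η = ∫ a ∇φ · ∇η`. -/
theorem integral_divFormOp_mul {a η : EuclideanSpace ℝ (Fin d) → ℝ}
    (hφ : HasCompactSupport φ)
    (hF : ∀ k, ContDiff ℝ 1 (fun x => a x * partialDeriv k φ x)) (hη : ContDiff ℝ 1 η) :
    ∫ x, divFormOp a φ x * η x = ∫ x, ∑ k, a x * partialDeriv k φ x * partialDeriv k η x := by
  have hFc : ∀ k, HasCompactSupport (fun x => a x * partialDeriv k φ x) := fun k =>
    hφ.of_isClosed_subset (isClosed_tsupport _) (tsupport_flux_subset a φ k)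
  have hFc' : ∀ k, HasCompactSupport (partialDeriv k fun x => a x * partialDeriv k φ x) :=
    fun k => (hFc k).of_isClosed_subset (isClosed_tsupport _) (tsupport_partialDeriv_subset _ k)
  have i1 : ∀ k, Integrable (fun x =>
      partialDeriv k (fun y => a y * partialDeriv k φ y) x * η x) := fun k =>
    ((continuous_partialDeriv (hF k) k).mul hη.continuous).integrable_of_hasCompactSupport
      (hFc' k).mul_right
  have i2 : ∀ k, Integrable (fun x => a x * partialDeriv k φ x * partialDeriv k η x) := fun k =>
    ((hF k).continuous.mul (continuous_partialDeriv hη k)).integrable_of_hasCompactSupport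
      (hFc k).mul_right
  have i3 : ∀ k, Integrable (fun x => a x * partialDeriv k φ x * η x) := fun k =>
    ((hF k).continuous.mul hη.continuous).integrable_of_hasCompactSupport (hFc k).mul_right
  rw [integral_finsetSum _ fun k _ => i2 k]
  have h : ∀ k, ∫ x, a x * partialDeriv k φ x * partialDeriv k η x
      = -∫ x, partialDeriv k (fun y => a y * partialDeriv k φ y) x * η x := fun k =>
    integral_mul_fderiv_eq_neg_fderiv_mul_of_integrable (i1 k) (i2 k) (i3 k)
      (fun x _ => (hF k).differentiable one_ne_zero x)
      (fun x _ => hη.differentiable one_ne_zero x)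
  rw [Finset.sum_congr rfl fun k _ => h k, Finset.sum_neg_distrib,
    ← integral_finsetSum _ fun k _ => i1 k, ← integral_neg]
  simp only [divFormOp, neg_mul, Finset.sum_mul]

/-- The regularized form of the tested inequality. -/
theorem IsMetricProjection.integral_regularized_le (hP : IsMetricProjection K P)
    (hc : IsClosed K) (hK : Convex ℝ K) (hφ : IsCc2 Kᶜ φ) {N p τ ε : ℝ} (hp : 1 < p)
    (hε : 0 < ε) (hmax : max δ δ' < 2) (hpos : 0 < N + p * min δ δ' - 2 * p)
    (hτ : τ = (N + p * min δ δ' - 2 * p) / p)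
    (hN : N = (d : ℝ) - (dimH (frontier K)).toReal) :
    ∫ x in tsupport φ, profileRatio δ δ' ‖x - P x‖ ^ p * (weightedRellichConst N p δ δ' *
        ((φ x ^ 2 + ε) ^ (p / 2) - ε ^ (p / 2)) - (p - 1) * τ ^ 2 * ε ^ (p / 2)) ≤
      ∫ x in tsupport φ, |divFormOp (fun x => weightProfile δ δ' ‖x - P x‖) φ x| *
        profileRatio δ δ' ‖x - P x‖ ^ (p - 1) * (φ x ^ 2 + ε) ^ ((p - 1) / 2) := by
  have hp0 : 0 < p := by linarith
  have hS := hφ.hasCompactSupport.isCompact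
  have hsub := hφ.tsupport_subset
  have hφ1 : ContDiff ℝ 1 φ := hφ.contDiff.of_le (by norm_num)
  set η := fun y => profileRatio δ δ' ‖y - P y‖ ^ (p - 1) * regPower p ε (φ y) with hη
  set ψ := fun y => fieldProfile p τ δ δ' ‖y - P y‖ * regPrimitive p ε (φ y) with hψ
  have sψ : tsupport ψ ⊆ tsupport φ :=
    tsupport_mul_subset_right.trans (tsupport_comp_subset regPrimitive_zero φ)
  have cη : ContDiff ℝ 1 η :=
    (hP.contDiffOn_comp_norm_sub hc fun _ hs => contDiffAt_profileRatio_rpow hs (p - 1)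
      ).mul_of_tsupport_subset hc.isOpen_compl ((contDiff_regPower hε).comp hφ1)
      ((tsupport_comp_subset regPower_zero φ).trans hsub)
  have cψ : ContDiff ℝ 1 ψ :=
    (hP.contDiffOn_comp_norm_sub hc fun _ hs => contDiffAt_fieldProfile p τ hs
      ).mul_of_tsupport_subset hc.isOpen_compl ((contDiff_regPrimitive hε).comp hφ1)
      ((tsupport_comp_subset regPrimitive_zero φ).trans hsub)
  have kψ : HasCompactSupport ψ := hS.of_isClosed_subset (isClosed_tsupport _) sψ
  -- The weak divergence bound needs ψ ≥ 0. Here the profile exponent is at most δ∨δ' < 2, so h ≥ 0.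
  have ψ0 : ∀ x, 0 ≤ ψ x := by
    intro x
    by_cases hx : x ∈ tsupport φ
    · have hD := hP.norm_sub_pos (hsub hx)
      refine mul_nonneg ?_ (regPrimitive_nonneg hp0 hε _)
      have he := (profileExponent_mem_Icc (δ := δ) (δ' := δ') hD).2
      have hτ0 : 0 < τ := by rw [hτ]; positivity
      exact mul_nonneg (by linarith) (mul_nonneg
        (Real.rpow_nonneg (profileRatio_pos hD).le _) (by linarith))
    · rw [image_eq_zero_of_notMem_tsupport fun h => hx (sψ h)]
  have hweak := hP.mul_integral_le_neg_integral_sum hc hK cψ kψ (sψ.trans hsub) ψ0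
  rw [← hN] at hweak
  have hparts := integral_divFormOp_mul (a := fun x => weightProfile δ δ' ‖x - P x‖)
    hφ.hasCompactSupport (fun k => hP.contDiff_flux hc hφ k) cη
  have c1 : Continuous fun x => ∑ k, weightProfile δ δ' ‖x - P x‖ * partialDeriv k φ x
      * partialDeriv k η x := continuous_finsetSum _ fun k _ =>
    (hP.contDiff_flux hc hφ k).continuous.mul (continuous_partialDeriv cη k)
  have z1 : ∀ x ∉ tsupport φ, ∑ k, weightProfile δ δ' ‖x - P x‖ * partialDeriv k φ x
      * partialDeriv k η x = 0 := fun x hx => Finset.sum_eq_zero fun k _ => by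
    rw [image_eq_zero_of_notMem_tsupport (f := partialDeriv k φ)
      fun h => hx (tsupport_partialDeriv_subset φ k h)]
    ring
  have c2 : Continuous fun x => ∑ k, (x - P x) k * partialDeriv k ψ x :=
    continuous_finsetSum _ fun k _ => ((EuclideanSpace.proj k :
      EuclideanSpace ℝ (Fin d) →L[ℝ] ℝ).continuous.comp hP.lipschitzWith_sub.continuous).mul
        (continuous_partialDeriv cψ k)
  have z2 : ∀ x ∉ tsupport φ, ∑ k, (x - P x) k * partialDeriv k ψ x = 0 :=
    fun x hx => Finset.sum_eq_zero fun k _ => by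
      rw [image_eq_zero_of_notMem_tsupport (f := partialDeriv k ψ)
        fun h => hx (sψ (tsupport_partialDeriv_subset ψ k h)), mul_zero]
  have z3 : ∀ x ∉ tsupport φ, ψ x = 0 := fun x hx =>
    image_eq_zero_of_notMem_tsupport fun h => hx (sψ h)
  have z4 : ∀ x ∉ tsupport φ,
      divFormOp (fun x => weightProfile δ δ' ‖x - P x‖) φ x * η x = 0 := fun x hx => by
    rw [divFormOp_eq_zero _ hx, zero_mul]
  rw [← setIntegral_eq_integral_of_forall_compl_eq_zero z1,
    ← setIntegral_eq_integral_of_forall_compl_eq_zero z4] at hparts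
  rw [← setIntegral_eq_integral_of_forall_compl_eq_zero z2,
    ← setIntegral_eq_integral_of_forall_compl_eq_zero z3] at hweak
  have i1 := c1.continuousOn.integrableOn_compact (μ := volume) hS
  have i2 := c2.continuousOn.integrableOn_compact (μ := volume) hS
  have i3 := cψ.continuous.continuousOn.integrableOn_compact (μ := volume) hS
  have i4 : IntegrableOn (fun x => (∑ k, (x - P x) k * partialDeriv k ψ x) + N * ψ x)
      (tsupport φ) := i2.add (i3.const_mul N)
  have cr : ∀ q : ℝ, ContinuousOn (fun x => profileRatio δ δ' ‖x - P x‖ ^ q) (tsupport φ) :=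
    fun q => ((hP.contDiffOn_comp_norm_sub hc fun _ hs =>
      contDiffAt_profileRatio_rpow hs q).continuousOn).mono hsub
  have cφ : ∀ a : ℝ, ContinuousOn (fun x => (φ x ^ 2 + ε) ^ a) (tsupport φ) := fun a =>
    ((hφ1.continuous.pow 2).add continuous_const).continuousOn.rpow_const
      fun x _ => Or.inl (show φ x ^ 2 + ε ≠ 0 by positivity)
  have cH := hP.continuous_divFormOp (δ := δ) (δ' := δ') hc hφ
  calc _ ≤ ∫ x in tsupport φ, ((∑ k, weightProfile δ δ' ‖x - P x‖ * partialDeriv k φ x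
          * partialDeriv k η x) + ((∑ k, (x - P x) k * partialDeriv k ψ x) + N * ψ x)) := by
        refine setIntegral_mono_on (ContinuousOn.integrableOn_compact hS ?_)
          (i1.add i4) hS.measurableSet fun x hx => ?_
        · exact (cr p).mul ((continuousOn_const.mul ((cφ _).sub continuousOn_const)).sub
            continuousOn_const)
        · exact hP.energy_density_ge (hsub hx) (hφ1.differentiable one_ne_zero x) hp hε hmax
            hpos hτ
    _ ≤ ∫ x in tsupport φ, ∑ k, weightProfile δ δ' ‖x - P x‖ * partialDeriv k φ x
          * partialDeriv k η x := by
        -- The discarded term ∫ (v·∇ψ + Nψ) is nonpositive by the weak divergence bound.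
        rw [integral_add i1 i4, integral_add i2 (i3.const_mul N),
          integral_const_mul]
        linarith
    _ = ∫ x in tsupport φ, divFormOp (fun x => weightProfile δ δ' ‖x - P x‖) φ x * η x :=
        hparts.symm
    _ ≤ _ := by
        refine setIntegral_mono_on
          ((cH.mul cη.continuous).continuousOn.integrableOn_compact hS)
          (ContinuousOn.integrableOn_compact hS
            ((cH.abs.continuousOn.mul (cr _)).mul (cφ _))) hS.measurableSet fun x hx => ?_
        have hb := Real.rpow_nonneg (profileRatio_pos (δ := δ) (δ' := δ')
          (hP.norm_sub_pos (hsub hx))).le (p - 1)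
        refine (le_abs_self _).trans ?_
        rw [hη, abs_mul, abs_mul, abs_of_nonneg hb, ← mul_assoc]
        exact mul_le_mul_of_nonneg_left (abs_regPower_le hε _) (mul_nonneg (abs_nonneg _) hb)

theorem IsMetricProjection.integral_tested_le (hP : IsMetricProjection K P)
    (hc : IsClosed K) (hK : Convex ℝ K) (hφ : IsCc2 Kᶜ φ) {N p : ℝ} (hp : 1 < p)
    (hmax : max δ δ' < 2) (hpos : 0 < N + p * min δ δ' - 2 * p)
    (hN : N = (d : ℝ) - (dimH (frontier K)).toReal) :
    weightedRellichConst N p δ δ' *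
        ∫ x in tsupport φ, (profileRatio δ δ' ‖x - P x‖ * |φ x|) ^ p ≤
      ∫ x in tsupport φ, |divFormOp (fun x => weightProfile δ δ' ‖x - P x‖) φ x| *
        (profileRatio δ δ' ‖x - P x‖ * |φ x|) ^ (p - 1) := by
  have hp0 : 0 < p := by linarith
  have hS := hφ.hasCompactSupport.isCompact
  have hsub := hφ.tsupport_subset
  have cr : ∀ q : ℝ, ContinuousOn (fun x => profileRatio δ δ' ‖x - P x‖ ^ q) (tsupport φ) :=
    fun q => ((hP.contDiffOn_comp_norm_sub hc fun _ hs =>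
      contDiffAt_profileRatio_rpow hs q).continuousOn).mono hsub
  have cφ := hφ.contDiff.continuous.continuousOn (s := tsupport φ)
  have cH := hP.continuous_divFormOp (δ := δ) (δ' := δ') hc hφ
  set c := weightedRellichConst N p δ δ'
  obtain ⟨τ, hτ⟩ : ∃ τ, τ = (N + p * min δ δ' - 2 * p) / p := ⟨_, rfl⟩
  have hR := tendsto_setIntegral_mul_sq_add_rpow (μ := volume) hS
    (w := fun x => |divFormOp (fun x => weightProfile δ δ' ‖x - P x‖) φ x| *
      profileRatio δ δ' ‖x - P x‖ ^ (p - 1)) (cH.abs.continuousOn.mul (cr (p - 1))) cφ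
    (show 0 < (p - 1) / 2 by linarith)
  have hL := tendsto_setIntegral_mul_sq_add_rpow (μ := volume) hS (cr p) cφ
    (show 0 < p / 2 by linarith)
  have hε : Tendsto (fun ε : ℝ => ε ^ (p / 2)) (𝓝[>] 0) (𝓝 0) := by
    have : ContinuousAt (fun ε : ℝ => ε ^ (p / 2)) 0 :=
      Real.continuousAt_rpow_const _ _ (Or.inr (by positivity))
    have h0 := this.tendsto
    rw [Real.zero_rpow (by positivity)] at h0
    exact h0.mono_left nhdsWithin_le_nhds
  -- All corrections from the regularization are multiples of ε^(p/2) ∫ b^p over the compact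
  -- support, so they vanish in the limit.
  have hL' := (hL.const_mul c).sub (hε.mul_const
    ((c + (p - 1) * τ ^ 2) * ∫ x in tsupport φ, profileRatio δ δ' ‖x - P x‖ ^ p))
  rw [zero_mul, sub_zero] at hL'
  have key := le_of_tendsto_of_tendsto hL' hR (by
    filter_upwards [self_mem_nhdsWithin] with ε hε
    have hε : 0 < ε := hε
    refine le_trans (Eq.le ?_) (hP.integral_regularized_le hc hK hφ hp hε hmax hpos hτ hN)
    have j1 : IntegrableOn (fun x => profileRatio δ δ' ‖x - P x‖ ^ p * (φ x ^ 2 + ε) ^ (p / 2))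
        (tsupport φ) := ContinuousOn.integrableOn_compact hS
      ((cr p).mul (((cφ.pow 2).add continuousOn_const).rpow_const fun x _ => Or.inr (by positivity)))
    have j2 : IntegrableOn (fun x => profileRatio δ δ' ‖x - P x‖ ^ p) (tsupport φ) :=
      ContinuousOn.integrableOn_compact hS (cr p)
    rw [← mul_assoc, ← integral_const_mul, ← integral_const_mul,
      ← integral_sub (j1.const_mul _) (j2.const_mul _)]
    refine integral_congr_ae (Eventually.of_forall fun x => ?_)
    simp only
    ring)
  refine le_trans (Eq.le ?_) (key.trans (Eq.le ?_))
  · congr 1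
    refine setIntegral_congr_fun hS.measurableSet fun x hx => ?_
    have hb := (profileRatio_pos (δ := δ) (δ' := δ') (hP.norm_sub_pos (hsub hx))).le
    simp only [Real.mul_rpow hb (abs_nonneg _)]
    ring_nf
  · refine setIntegral_congr_fun hS.measurableSet fun x hx => ?_
    have hb := (profileRatio_pos (δ := δ) (δ' := δ') (hP.norm_sub_pos (hsub hx))).le
    simp only [Real.mul_rpow hb (abs_nonneg _)]
    rw [mul_assoc, mul_div_cancel₀ _ (two_ne_zero' ℝ)]

/-- The weighted Rellich inequality on the complement of a convex set. -/
theorem IsMetricProjection.rellich (hP : IsMetricProjection K P)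
    (hc : IsClosed K) (hK : Convex ℝ K) (hφ : IsCc2 Kᶜ φ) {N p : ℝ} (hp : 1 < p)
    (hmax : max δ δ' < 2) (hpos : 0 < N + p * min δ δ' - 2 * p)
    (hcp : 0 ≤ weightedRellichConst N p δ δ')
    (hN : N = (d : ℝ) - (dimH (frontier K)).toReal) :
    weightedRellichConst N p δ δ' ^ p *
        ∫ x in Kᶜ, |weightProfile δ δ' ‖x - P x‖ * ‖x - P x‖ ^ (-2 : ℤ) * φ x| ^ p ≤
      ∫ x in Kᶜ, |divFormOp (fun x => weightProfile δ δ' ‖x - P x‖) φ x| ^ p := by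
  have hp0 : 0 < p := by linarith
  have hS := hφ.hasCompactSupport.isCompact
  have hsub := hφ.tsupport_subset
  have cH := hP.continuous_divFormOp (δ := δ) (δ' := δ') hc hφ
  have hb0 : ∀ x, 0 ≤ profileRatio δ δ' ‖x - P x‖ := fun x =>
    div_nonneg (by unfold weightProfile; positivity) (by positivity)
  have e : ∀ x, |weightProfile δ δ' ‖x - P x‖ * ‖x - P x‖ ^ (-2 : ℤ) * φ x|
      = profileRatio δ δ' ‖x - P x‖ * |φ x| := fun x => by
    rw [abs_mul, ← abs_of_nonneg (hb0 x), profileRatio, div_eq_mul_inv, zpow_neg]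
    norm_cast
  simp only [e]
  have cu : ContinuousOn (fun x => (profileRatio δ δ' ‖x - P x‖ * |φ x|) ^ (p - 1))
      (tsupport φ) :=
    (((hP.contDiffOn_comp_norm_sub hc fun _ hs =>
      contDiffAt_profileRatio hs).continuousOn.mono hsub).mul
        hφ.contDiff.continuous.abs.continuousOn).rpow_const fun x _ => Or.inr (by linarith)
  -- Both integrands vanish off the support of φ. On this compact subset of Ω the weights are
  -- continuous, which gives the L^p memberships for Hölder.
  rw [setIntegral_eq_of_subset_of_forall_sdiff_eq_zero hc.isOpen_compl.measurableSet hsub,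
    setIntegral_eq_of_subset_of_forall_sdiff_eq_zero hc.isOpen_compl.measurableSet hsub]
  · exact rpow_mul_integral_rpow_le_of_le_integral_mul hp hcp (fun x => abs_nonneg _)
      (fun x => mul_nonneg (hb0 x) (abs_nonneg _))
      (cH.abs.continuousOn.memLp_restrict_of_isCompact hS _)
      (cu.memLp_restrict_of_isCompact hS _)
      (hP.integral_tested_le hc hK hφ hp hmax hpos hN)
  · intro x hx
    rw [divFormOp_eq_zero _ hx.2, abs_zero, Real.zero_rpow hp0.ne']
  · intro x hx
    rw [image_eq_zero_of_notMem_tsupport hx.2, abs_zero, mul_zero, Real.zero_rpow hp0.ne']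

end Rellich

theorem theorem1p2 (d : ℕ) (p δ δ' dH : ℝ) (hp : 1 < p)
    (hδ : δ ∈ Set.Ico (0 : ℝ) 2) (hδ' : δ' ∈ Set.Ico (0 : ℝ) 2)
    (hcond : 2 * p * |δ - δ'| * (2 - max δ δ')⁻¹ ≤ (d : ℝ) - dH + p * min δ δ' - 2 * p)
    (hpos : 0 < (d : ℝ) - dH + p * min δ δ' - 2 * p) :
    ∃ cp : ℝ, 0 < cp ∧ cp ≤ rellichConst d dH p δ δ' ∧
      (δ = δ' → cp = rellichConst d dH p δ δ') ∧
      ∀ K Ω : Set (EuclideanSpace ℝ (Fin d)), IsClosed K → Convex ℝ K → K.Nonempty → Ω = Kᶜ →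
        (dimH (frontier Ω)).toReal = dH →
        ∀ φ : EuclideanSpace ℝ (Fin d) → ℝ, IsCc2 Ω φ →
          cp ^ p * ∫ x in Ω, |domainWeight δ δ' Ω x * boundaryDist Ω x ^ (-2 : ℤ) * φ x| ^ p ≤
            ∫ x in Ω, |divFormOp (domainWeight δ δ' Ω) φ x| ^ p := by
  have hmax : max δ δ' < 2 := max_lt hδ.2 hδ'.2
  have hcp := weightedRellichConst_pos hp hmax hcond hpos
  refine ⟨weightedRellichConst (d - dH) p δ δ', hcp, weightedRellichConst_le d hp hpos, ?_, ?_⟩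
  · rintro rfl
    exact weightedRellichConst_self d hp δ
  · rintro K Ω hc hK hne rfl hdim φ hφ
    obtain ⟨P, hP⟩ := exists_isMetricProjection hc hK hne
    have h := hP.rellich hc hK hφ hp hmax hpos hcp.le (by rw [← hdim, frontier_compl])
    simpa only [hP.domainWeight_eq, boundaryDist, compl_compl, hP.infDist_eq] using h
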